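/- For $t=(t_1,t_2,t_3)\in\mathbb{R}^3$ let $$[t]^\wedge=\begin{pmatrix}0&-t_3&t_2\\ t_3&0&-t_1\\ -t_2&t_1&0\end{pmatrix},$$ and let $$\mathscr{L}=\left\{\begin{pmatrix}R&0\\ [t]^\wedge R&R\end{pmatrix} : R\in\mathbb{R}^{3\times3},\ R^{\mathrm T}R=I,\ t\in\mathbb{R}^3\right\}\subset\mathbb{R}^{6\times 6}.$$ Then $\mathscr{L}$ is closed under matrix multiplication, every element of $\mathscr{L}$ is invertible with inverse in $\mathscr{L}$, and $\mathscr{L}$ is topologically closed in $\mathrm{GL}(6,\mathbb{R})$. Moreover, $\mathscr{L}$ is a subgroup of $\mathrm{GL}(6,\mathbb{R})$ (with matrix multiplication as group operation) and an embedded Lie subgroup: equipped with the subspace topology, it admits a smooth manifold structure for which multiplication and inversion are smooth and the inclusion $\mathscr{L}\hookrightarrow\mathrm{GL}(6,\mathbb{R})$ is a smooth embedding. -/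

import Mathlib

open scoped Manifold ContDiff MatrixGroups

/-
The operator norm on matrices makes the matrix algebra a complete normed algebra, so that its unit
group `GL` carries the standard Lie group structure, as an open subset of the matrix space. All
norms on this finite-dimensional space are equivalent, so the choice of the norm is immaterial.
-/
attribute [local instance] Matrix.linftyOpNormedRing
attribute [local instance] Matrix.linftyOpNormedAlgebra

/-- Real `6 × 6` matrices, with rows and columns indexed by two blocks of size three. -/
abbrev Mat6 : Type := Matrix (Fin 3 ⊕ Fin 3) (Fin 3 ⊕ Fin 3) ℝ

/-- The group `GL(6, ℝ)` of invertible real `6 × 6` matrices. -/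
abbrev GL6 : Type := GL (Fin 3 ⊕ Fin 3) ℝ

/-- The standard manifold structure of `GL(6, ℝ)`: the one of an open subset of the matrix space,
whose single chart is the inclusion. It is Mathlib's structure on the units of a complete normed
ring, restated so that the entrywise topology of matrices and the topology of the norm, which are
the same, are matched. -/
noncomputable instance chartedSpaceGL6 :
    @ChartedSpace Mat6 PseudoMetricSpace.toUniformSpace.toTopologicalSpace GL6 _ :=
  Units.instChartedSpace (R := Mat6)

/-- With this structure `GL(6, ℝ)` is a Lie group. -/
theorem lieGroupGL6 : LieGroup 𝓘(ℝ, Mat6) ∞ GL6 :=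
  Units.instLieGroupModelWithCornersSelf (R := Mat6)

/-- The skew-symmetric matrix `[t]^∧` of a vector `t ∈ ℝ³`. -/
def hat (t : Fin 3 → ℝ) : Matrix (Fin 3) (Fin 3) ℝ :=
  !![0, -t 2, t 1;
     t 2, 0, -t 0;
     -t 1, t 0, 0]

/-- The set of the `6 × 6` block matrices `[[R, 0], [[t]^∧ R, R]]` with `R` a real orthogonal
`3 × 3` matrix and `t ∈ ℝ³`. -/
def inducedAdjointSet : Set Mat6 :=
  {M | ∃ R ∈ Matrix.orthogonalGroup (Fin 3) ℝ, ∃ t : Fin 3 → ℝ,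
    M = Matrix.fromBlocks R 0 (hat t * R) R}

/-- A subgroup `H` of `GL(6, ℝ)` is an embedded Lie subgroup if, with the subspace topology and the
group law of `GL(6, ℝ)`, it admits a smooth manifold structure (modelled on some `ℝ^d`) for which
it is a Lie group and the inclusion `H → GL(6, ℝ)` is a smooth embedding. -/
def IsEmbeddedLieSubgroup (H : Subgroup GL6) : Prop :=
  ∃ (d : ℕ) (_ : ChartedSpace (EuclideanSpace ℝ (Fin d)) H),
    LieGroup (𝓡 d) ∞ H ∧
    Manifold.IsSmoothEmbedding (𝓡 d) 𝓘(ℝ, Mat6) ∞ (Subtype.val : H → GL6)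

/-!
Let `N = [[0, 0], [1, 0]]` and let `σ` be the anti-automorphism that transposes a block matrix and
exchanges its diagonal blocks. A block matrix commutes with `N` iff it has the form
`[[R, 0], [C, R]]`, and then `σ(M) M = 1` says that `R` is orthogonal and that `C R⁻¹` is
skew-symmetric. So the set `𝓛` is given by the polynomial equations `M N = N M` and `σ(M) M = 1`,
which are preserved by products and inverses and define a closed set.

The Cayley transform `a ↦ (1 - a) (1 + a)⁻¹` respects commutation with `N` and turns `σ(a) a = 1`
into the linear equation `σ(c) = -c`. It is a chart of the unit group around `1`, in which `𝓛` is a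
linear subspace, and translating it gives such a chart around every point of `𝓛`. The product and
the inverse of `𝓛` are smooth because a continuous map into an immersed manifold is smooth as soon
as its composition with the immersion is.
-/

open scoped Ring
open MulOpposite

section Cayley

variable {R : Type*} [Ring R] {a b : R}

/-- The Cayley transform `(1 - a) (1 + a)⁻¹`, an involution of the elements with `1 + a` invertible
that turns the orthogonality equation into a linear one. It is written as `2 (1 + a)⁻¹ - 1`, and
is `-1` by convention if `1 + a` is not invertible. -/
noncomputable def cayley (a : R) : R := 2 * (1 + a)⁻¹ʳ - 1

lemma one_add_cayley (a : R) : 1 + cayley a = 2 * (1 + a)⁻¹ʳ :=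
  add_sub_cancel _ _

lemma isUnit_one_add_cayley (h2 : IsUnit (2 : R)) (ha : IsUnit (1 + a)) :
    IsUnit (1 + cayley a) :=
  one_add_cayley a ▸ h2.mul ha.ringInverse

lemma cayley_cayley (h2 : IsUnit (2 : R)) (ha : IsUnit (1 + a)) : cayley (cayley a) = a :=
  calc cayley (cayley a)
      = 2 * ((1 + a) * 2⁻¹ʳ) - 1 := by
        rw [cayley, one_add_cayley, Ring.inverse_mul (.inl h2), Ring.inverse_inverse ha]
    _ = (1 + a) * (2 * 2⁻¹ʳ) - 1 := by rw [(Commute.ofNat_left 2 (1 + a)).left_comm]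
    _ = a := by rw [Ring.mul_inverse_cancel _ h2, mul_one, add_sub_cancel_left]

lemma commute_cayley_right (h : Commute b a) : Commute b (cayley a) := by
  have h_inv : Commute b (1 + a)⁻¹ʳ := by
    by_cases ha : IsUnit (1 + a)
    · rw [Ring.inverse_of_isUnit ha]
      exact Commute.units_inv_right (u := ha.unit) ((Commute.one_right b).add_right h)
    · rw [Ring.inverse_non_unit _ ha]
      exact Commute.zero_right b
  exact ((Commute.ofNat_right b 2).mul_right h_inv).sub_right (Commute.one_right b)

lemma commute_cayley_right_iff (h2 : IsUnit (2 : R)) (ha : IsUnit (1 + a)) :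
    Commute b (cayley a) ↔ Commute b a :=
  ⟨fun h => cayley_cayley h2 ha ▸ commute_cayley_right h, commute_cayley_right⟩

lemma cayley_eq_neg_cayley_iff (h2 : IsUnit (2 : R)) (ha : IsUnit (1 + a)) (hb : IsUnit (1 + b)) :
    cayley b = -cayley a ↔ b * a = 1 := by
  have h_sum : cayley b + cayley a = 2 * ((1 + b)⁻¹ʳ * ((1 + b) + (1 + a)) * (1 + a)⁻¹ʳ - 1) := by
    rw [← Ring.inverse_add_inverse (iff_of_true hb ha)]
    simp only [cayley]
    noncomm_ring
  rw [eq_neg_iff_add_eq_zero, h_sum, h2.mul_right_eq_zero, sub_eq_zero, eq_comm,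
    Ring.eq_mul_inverse_iff_mul_eq _ _ _ ha, one_mul, eq_comm,
    Ring.inverse_mul_eq_iff_eq_mul _ _ _ hb, ← sub_eq_zero, ← sub_eq_zero (a := b * a),
    ← neg_eq_zero]
  congr! 1
  noncomm_ring

variable (σ : R →+* Rᵐᵒᵖ)

lemma isUnit_one_add_unop_map (ha : IsUnit (1 + a)) : IsUnit (1 + unop (σ a)) := by
  simpa using (ha.map σ).unop

lemma unop_map_cayley (ha : IsUnit (1 + a)) : unop (σ (cayley a)) = cayley (unop (σ a)) := by
  have h_inv : unop (σ (1 + a)⁻¹ʳ) = (1 + unop (σ a))⁻¹ʳ := by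
    rw [← one_mul (1 + unop (σ a))⁻¹ʳ,
      Ring.eq_mul_inverse_iff_mul_eq _ _ _ (isUnit_one_add_unop_map σ ha)]
    simpa using congrArg (fun x => unop (σ x)) (Ring.mul_inverse_cancel _ ha)
  simp only [cayley, map_sub, map_mul, map_ofNat, map_one, unop_sub, unop_mul, unop_ofNat, unop_one,
    h_inv]
  rw [(Commute.ofNat_right _ 2).eq]

lemma unop_map_cayley_eq_neg_iff (h2 : IsUnit (2 : R)) (ha : IsUnit (1 + a)) :
    unop (σ (cayley a)) = -cayley a ↔ unop (σ a) * a = 1 := by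
  rw [unop_map_cayley σ ha, cayley_eq_neg_cayley_iff h2 ha (isUnit_one_add_unop_map σ ha)]

end Cayley

section UnitaryCentralizer

variable {k R : Type*} [CommRing k] [Ring R] [Algebra k R] (σ : R →ₐ[k] Rᵐᵒᵖ) (s : Set R)

/-- The elements commuting with `s` that are unitary for the anti-endomorphism `σ`. An
anti-endomorphism is encoded as a homomorphism to the opposite algebra. -/
def unitaryCentralizer : Submonoid R where
  carrier := {a | a ∈ s.centralizer ∧ unop (σ a) * a = 1}
  one_mem' := ⟨Set.one_mem_centralizer, by simp⟩
  mul_mem' := by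
    rintro a b ⟨ha, hσa⟩ ⟨hb, hσb⟩
    refine ⟨Set.mul_mem_centralizer ha hb, ?_⟩
    rw [map_mul, unop_mul, mul_assoc, ← mul_assoc _ a, hσa, one_mul, hσb]

/-- The elements commuting with `s` that are skew for the anti-endomorphism `σ`: the Lie algebra of
the group of units of `unitaryCentralizer σ s`. -/
def skewCentralizer : Submodule k R where
  carrier := {a | a ∈ s.centralizer ∧ unop (σ a) = -a}
  zero_mem' := ⟨Set.zero_mem_centralizer, by simp⟩
  add_mem' := by
    rintro a b ⟨ha, hσa⟩ ⟨hb, hσb⟩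
    exact ⟨Set.add_mem_centralizer ha hb, by rw [map_add, unop_add, hσa, hσb, neg_add]⟩
  smul_mem' := by
    rintro c a ⟨ha, hσa⟩
    exact ⟨(Subalgebra.centralizer k s).smul_mem ha c, by rw [map_smul, unop_smul, hσa, smul_neg]⟩

variable {σ s}

lemma mem_unitaryCentralizer_iff {a : R} :
    a ∈ unitaryCentralizer σ s ↔ a ∈ s.centralizer ∧ unop (σ a) * a = 1 := Iff.rfl

lemma inv_mem_unitaryCentralizer {u : Rˣ} (hu : (u : R) ∈ unitaryCentralizer σ s) :
    ((u⁻¹ : Rˣ) : R) ∈ unitaryCentralizer σ s := by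
  refine ⟨fun x hx => Commute.units_inv_right (hu.1 x hx), ?_⟩
  have hσu : unop (σ u) = (u⁻¹ : Rˣ) := Units.eq_inv_of_mul_eq_one_right hu.2
  rw [← hσu, ← unop_mul, hσu, ← map_mul, Units.mul_inv, map_one, unop_one]

lemma mem_units_unitaryCentralizer_iff {u : Rˣ} :
    u ∈ (unitaryCentralizer σ s).units ↔ (u : R) ∈ unitaryCentralizer σ s :=
  ⟨fun hu => hu.1, fun hu => ⟨hu, inv_mem_unitaryCentralizer hu⟩⟩

lemma isUnit_of_mem_unitaryCentralizer [IsDedekindFiniteMonoid R] {a : R}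
    (ha : a ∈ unitaryCentralizer σ s) : IsUnit a :=
  IsUnit.of_mul_eq_one_right _ ha.2

lemma ringInverse_mem_unitaryCentralizer [IsDedekindFiniteMonoid R] {a : R}
    (ha : a ∈ unitaryCentralizer σ s) : a⁻¹ʳ ∈ unitaryCentralizer σ s := by
  obtain ⟨u, rfl⟩ := isUnit_of_mem_unitaryCentralizer ha
  rw [Ring.inverse_unit]
  exact inv_mem_unitaryCentralizer ha

lemma image_val_units_unitaryCentralizer [IsDedekindFiniteMonoid R] :
    (fun u : Rˣ => (u : R)) '' (unitaryCentralizer σ s).units = unitaryCentralizer σ s := by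
  ext a
  constructor
  · rintro ⟨u, hu, rfl⟩
    exact hu.1
  · intro ha
    obtain ⟨u, rfl⟩ := isUnit_of_mem_unitaryCentralizer ha
    exact ⟨u, mem_units_unitaryCentralizer_iff.2 ha, rfl⟩

lemma cayley_mem_skewCentralizer_iff (h2 : IsUnit (2 : R)) {a : R} (ha : IsUnit (1 + a)) :
    cayley a ∈ skewCentralizer σ s ↔ a ∈ unitaryCentralizer σ s :=
  and_congr (forall₂_congr fun _ _ => commute_cayley_right_iff h2 ha)
    (unop_map_cayley_eq_neg_iff σ.toRingHom h2 ha)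

lemma isClosed_unitaryCentralizer [TopologicalSpace R] [ContinuousMul R] [T2Space R]
    (hσ : Continuous σ) : IsClosed (unitaryCentralizer σ s : Set R) :=
  (Set.isClosed_centralizer s).inter
    (isClosed_eq ((continuous_unop.comp hσ).mul continuous_id) continuous_const)

end UnitaryCentralizer

section Slice

open Set Manifold

variable {𝕜 E E' F N : Type*} [NontriviallyNormedField 𝕜] [NormedAddCommGroup E] [NormedSpace 𝕜 E]
  [NormedAddCommGroup E'] [NormedSpace 𝕜 E'] [NormedAddCommGroup F] [NormedSpace 𝕜 F]
  [TopologicalSpace N] {S : Set N} {L : (E × F) ≃L[𝕜] E'} {ψ : OpenPartialHomeomorph N E'}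

/-- A slice chart of a subset `S`: a chart whose target is split as `E × F` by `L`, in which `S` is
cut out by the vanishing of the second component. -/
def IsSliceChart (L : (E × F) ≃L[𝕜] E') (ψ : OpenPartialHomeomorph N E') (S : Set N) : Prop :=
  ∀ y ∈ ψ.source, y ∈ S ↔ (L.symm (ψ y)).2 = 0

namespace IsSliceChart

lemma apply_fst_zero (h : IsSliceChart L ψ S) {y : N} (hy : y ∈ ψ.source) (hyS : y ∈ S) :
    L ((L.symm (ψ y)).1, 0) = ψ y := by
  rw [← (h y hy).1 hyS, Prod.mk.eta, L.apply_symm_apply]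

lemma symm_mem (h : IsSliceChart L ψ S) {u : E} (hu : L (u, 0) ∈ ψ.target) :
    ψ.symm (L (u, 0)) ∈ S :=
  (h _ (ψ.map_target hu)).2 (by simp only [ψ.right_inv hu, L.symm_apply_apply])

open scoped Classical in
/-- The chart of `S` given by the first component of a slice chart. The point `x` is the junk value
of its inverse outside of the target. -/
noncomputable def chart (h : IsSliceChart L ψ S) (x : S) : OpenPartialHomeomorph S E where
  toFun y := (L.symm (ψ y)).1
  invFun u := if hu : L (u, 0) ∈ ψ.target then ⟨_, h.symm_mem hu⟩ else x
  source := Subtype.val ⁻¹' ψ.source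
  target := {u | L (u, 0) ∈ ψ.target}
  map_source' y hy := by
    simpa only [mem_ofPred_eq, h.apply_fst_zero hy y.2] using ψ.map_source hy
  map_target' u hu := by
    simpa only [mem_preimage, dif_pos (mem_ofPred_eq ▸ hu)] using ψ.map_target hu
  left_inv' y hy := by
    ext
    simp only [h.apply_fst_zero hy y.2, dif_pos (ψ.map_source hy), ψ.left_inv hy]
  right_inv' u hu := by
    simp only [dif_pos (mem_ofPred_eq ▸ hu), ψ.right_inv hu, L.symm_apply_apply]
  open_source := ψ.open_source.preimage continuous_subtype_val
  open_target := ψ.open_target.preimage (by fun_prop)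
  continuousOn_toFun := (continuous_fst.comp L.symm.continuous).comp_continuousOn <|
    ψ.continuousOn.comp continuous_subtype_val.continuousOn (mapsTo_preimage _ _)
  continuousOn_invFun := by
    rw [Topology.IsInducing.subtypeVal.continuousOn_iff]
    refine (ψ.continuousOn_symm.comp (f := fun u : E => L (u, 0)) (by fun_prop)
      fun _ hu => hu).congr fun u hu => ?_
    exact congrArg Subtype.val (dif_pos hu)

@[simp]
lemma chart_apply (h : IsSliceChart L ψ S) (x y : S) : h.chart x y = (L.symm (ψ y)).1 := rfl

@[simp]
lemma mem_chart_target (h : IsSliceChart L ψ S) {x : S} {u : E} :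
    u ∈ (h.chart x).target ↔ L (u, 0) ∈ ψ.target := Iff.rfl

lemma coe_chart_symm_apply (h : IsSliceChart L ψ S) (x : S) {u : E} (hu : L (u, 0) ∈ ψ.target) :
    ((h.chart x).symm u : N) = ψ.symm (L (u, 0)) :=
  congrArg Subtype.val (dif_pos hu)

variable [ChartedSpace E' N] {n : ℕ∞ω}

lemma contDiffOn_chart_symm_trans_chart {φ : OpenPartialHomeomorph N E'}
    (hφ : IsSliceChart L φ S) (hψ : IsSliceChart L ψ S)
    (hφ_mem : φ ∈ IsManifold.maximalAtlas 𝓘(𝕜, E') n N)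
    (hψ_mem : ψ ∈ IsManifold.maximalAtlas 𝓘(𝕜, E') n N) (x y : S) :
    ContDiffOn 𝕜 n ((hφ.chart x).symm ≫ₕ hψ.chart y) ((hφ.chart x).symm ≫ₕ hψ.chart y).source := by
  have h_ambient : ContDiffOn 𝕜 n (ψ ∘ φ.symm) (φ.target ∩ φ.symm ⁻¹' ψ.source) :=
    contMDiffOn_iff_contDiffOn.1 <|
      (contMDiffOn_of_mem_maximalAtlas hψ_mem).comp
        ((contMDiffOn_symm_of_mem_maximalAtlas hφ_mem).mono inter_subset_left) fun _ hu => hu.2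
  have h_slice : ContDiffOn 𝕜 n (fun u : E => (L.symm (ψ (φ.symm (L (u, 0))))).1)
      ((fun u : E => L (u, 0)) ⁻¹' (φ.target ∩ φ.symm ⁻¹' ψ.source)) :=
    (contDiff_fst.comp L.symm.contDiff).comp_contDiffOn <| h_ambient.comp
      (L.contDiff.comp (contDiff_id.prodMk contDiff_const)).contDiffOn (mapsTo_preimage _ _)
  have h_symm : ∀ u ∈ ((hφ.chart x).symm ≫ₕ hψ.chart y).source,
      ((hφ.chart x).symm u : N) = φ.symm (L (u, 0)) := fun u hu =>
    hφ.coe_chart_symm_apply x hu.1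
  refine (h_slice.mono fun u hu => ⟨hu.1, ?_⟩).congr fun u hu => ?_
  · rw [mem_preimage, ← h_symm u hu]
    exact hu.2
  · rw [OpenPartialHomeomorph.trans_apply, chart_apply, h_symm u hu]

end IsSliceChart

variable [ChartedSpace E' N] {n : ℕ∞ω}

theorem exists_chartedSpace_isSmoothEmbedding_of_isSliceChart (ψ : S → OpenPartialHomeomorph N E')
    (hψ : ∀ x, IsSliceChart L (ψ x) S) (hmem : ∀ x, ψ x ∈ IsManifold.maximalAtlas 𝓘(𝕜, E') n N)
    (hx : ∀ x : S, (x : N) ∈ (ψ x).source) :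
    ∃ _ : ChartedSpace E S, IsManifold 𝓘(𝕜, E) n S ∧
      IsSmoothEmbedding 𝓘(𝕜, E) 𝓘(𝕜, E') n (Subtype.val : S → N) := by
  let _ : ChartedSpace E S :=
    { atlas := range fun x => (hψ x).chart x
      chartAt := fun x => (hψ x).chart x
      mem_chart_source := hx
      chart_mem_atlas := mem_range_self }
  have h_manifold : IsManifold 𝓘(𝕜, E) n S := by
    apply isManifold_of_contDiffOn
    rintro _ _ ⟨x, rfl⟩ ⟨y, rfl⟩
    simpa using (hψ x).contDiffOn_chart_symm_trans_chart (hψ y) (hmem x) (hmem y) x y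
  have h_immersion : IsImmersionOfComplement F 𝓘(𝕜, E) 𝓘(𝕜, E') n (Subtype.val : S → N) := by
    intro x
    refine .mk_of_charts L ((hψ x).chart x) (ψ x) (hx x) (hx x)
      (IsManifold.chart_mem_maximalAtlas x) (hmem x) subset_rfl fun u hu => ?_
    replace hu : L (u, 0) ∈ (ψ x).target := by simpa using hu
    simp [(hψ x).coe_chart_symm_apply x hu, (ψ x).right_inv hu]
  exact ⟨_, h_manifold, h_immersion.isImmersion, .subtypeVal⟩

end Slice

section LieSubgroup

open Set Manifold

variable {𝕜 E E' F G : Type*} [NontriviallyNormedField 𝕜] [NormedAddCommGroup E] [NormedSpace 𝕜 E]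
  [NormedAddCommGroup E'] [NormedSpace 𝕜 E'] [NormedAddCommGroup F] [NormedSpace 𝕜 F]
  [Group G] [TopologicalSpace G] {L : (E × F) ≃L[𝕜] E'}
  {ψ : OpenPartialHomeomorph G E'} {H : Subgroup G}

/-- The translate of a chart `ψ` of a Lie group around `1` to a chart around `g`. -/
def translateChart [ContinuousMul G] (ψ : OpenPartialHomeomorph G E') (g : G) :
    OpenPartialHomeomorph G E' :=
  (Homeomorph.mulLeft g⁻¹).toOpenPartialHomeomorph ≫ₕ ψ

@[simp]
lemma translateChart_apply [ContinuousMul G] (g y : G) : translateChart ψ g y = ψ (g⁻¹ * y) := rfl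

@[simp]
lemma mem_translateChart_source [ContinuousMul G] {g y : G} :
    y ∈ (translateChart ψ g).source ↔ g⁻¹ * y ∈ ψ.source := by
  simp [translateChart]

lemma isSliceChart_translateChart [ContinuousMul G] (hψ : IsSliceChart L ψ (H : Set G)) (g : H) :
    IsSliceChart L (translateChart ψ (g : G)) (H : Set G) := by
  intro y hy
  rw [translateChart_apply, ← hψ _ (mem_translateChart_source.1 hy)]
  exact (H.mul_mem_cancel_left (H.inv_mem g.2)).symm

variable [ChartedSpace E' G] {n : ℕ∞ω}

theorem lieGroup_of_isSmoothEmbedding [LieGroup 𝓘(𝕜, E') n G] [ChartedSpace E H]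
    [IsManifold 𝓘(𝕜, E) n H]
    (h : IsSmoothEmbedding 𝓘(𝕜, E) 𝓘(𝕜, E') n (Subtype.val : H → G)) :
    LieGroup 𝓘(𝕜, E) n H where
  contMDiff_mul := by
    have := topologicalGroup_of_lieGroup 𝓘(𝕜, E') n (G := G)
    exact (ContMDiff.iff_comp_isImmersion h.isImmersion).2
      ⟨continuous_mul, (h.contMDiff.comp contMDiff_fst).mul (h.contMDiff.comp contMDiff_snd)⟩
  contMDiff_inv := by
    have := topologicalGroup_of_lieGroup 𝓘(𝕜, E') n (G := G)
    exact (ContMDiff.iff_comp_isImmersion h.isImmersion).2 ⟨continuous_inv, h.contMDiff.inv⟩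

lemma translateChart_mem_maximalAtlas [ContinuousMul G] [LieGroup 𝓘(𝕜, E') n G]
    (hψ : ψ ∈ IsManifold.maximalAtlas 𝓘(𝕜, E') n G) (g : G) :
    translateChart ψ g ∈ IsManifold.maximalAtlas 𝓘(𝕜, E') n G := by
  apply OpenPartialHomeomorph.mem_maximalAtlas_of_contMDiffOn
  · exact (contMDiffOn_of_mem_maximalAtlas hψ).comp (contMDiff_mul_left (a := g⁻¹)).contMDiffOn
      fun y hy => mem_translateChart_source.1 hy
  · refine ((contMDiff_mul_left (a := g)).comp_contMDiffOn
      (contMDiffOn_symm_of_mem_maximalAtlas hψ)).congr_mono (fun u _ => ?_) ?_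
    · simp [translateChart, Homeomorph.mulLeft_symm]
    · simp [translateChart]

theorem exists_chartedSpace_lieGroup_of_isSliceChart [LieGroup 𝓘(𝕜, E') n G]
    (hψ : IsSliceChart L ψ (H : Set G)) (hmem : ψ ∈ IsManifold.maximalAtlas 𝓘(𝕜, E') n G)
    (h_one : 1 ∈ ψ.source) :
    ∃ _ : ChartedSpace E H, LieGroup 𝓘(𝕜, E) n H ∧
      IsSmoothEmbedding 𝓘(𝕜, E) 𝓘(𝕜, E') n (Subtype.val : H → G) := by
  have := topologicalGroup_of_lieGroup 𝓘(𝕜, E') n (G := G)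
  obtain ⟨_, h_manifold, h_emb⟩ := exists_chartedSpace_isSmoothEmbedding_of_isSliceChart
    (fun g : (H : Set G) => translateChart ψ (g : G)) (isSliceChart_translateChart hψ)
    (fun g => translateChart_mem_maximalAtlas hmem g)
    (fun g => by rwa [mem_translateChart_source, inv_mul_cancel])
  let _ : ChartedSpace E H := ‹ChartedSpace E (H : Set G)›
  have : IsManifold 𝓘(𝕜, E) n H := h_manifold
  exact ⟨_, lieGroup_of_isSmoothEmbedding h_emb, h_emb⟩

end LieSubgroup

section CayleyChart

open Manifold

variable {𝕜 R : Type*} [NontriviallyNormedField 𝕜] [NormedRing R] [NormedAlgebra 𝕜 R]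
  [CompleteSpace R] {n : ℕ∞ω}

lemma contDiffOn_cayley : ContDiffOn 𝕜 n (cayley : R → R) {a | IsUnit (1 + a)} := by
  rintro _ ⟨u, hu⟩
  have h_inv : ContDiffAt 𝕜 n Ring.inverse (u : R) := contDiffAt_ringInverse 𝕜 u
  rw [hu] at h_inv
  exact ((contDiffAt_const.mul (h_inv.comp _ (contDiffAt_const.add contDiffAt_id))).sub
    contDiffAt_const).contDiffWithinAt

lemma continuousOn_cayley : ContinuousOn (cayley : R → R) {a | IsUnit (1 + a)} := by
  refine (continuousOn_const.mul ?_).sub continuousOn_const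
  rintro _ ⟨u, hu⟩
  have h_inv : ContinuousAt Ring.inverse (u : R) := NormedRing.inverse_continuousAt u
  rw [hu] at h_inv
  exact (h_inv.comp (by fun_prop)).continuousWithinAt

/-- The Cayley transform as a chart of the units around `1`. -/
noncomputable def cayleyChart (h2 : IsUnit (2 : R)) : OpenPartialHomeomorph Rˣ R :=
  chartAt R 1 ≫ₕ
  { toFun := cayley
    invFun := cayley
    source := {a | IsUnit (1 + a)}
    target := {a | IsUnit (1 + a)}
    map_source' := fun _ ha => isUnit_one_add_cayley h2 ha
    map_target' := fun _ ha => isUnit_one_add_cayley h2 ha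
    left_inv' := fun _ ha => cayley_cayley h2 ha
    right_inv' := fun _ ha => cayley_cayley h2 ha
    open_source := Units.isOpen.preimage (continuous_const.add continuous_id)
    open_target := Units.isOpen.preimage (continuous_const.add continuous_id)
    continuousOn_toFun := continuousOn_cayley
    continuousOn_invFun := continuousOn_cayley }

@[simp]
lemma cayleyChart_apply (h2 : IsUnit (2 : R)) (u : Rˣ) : cayleyChart h2 u = cayley (u : R) := rfl

@[simp]
lemma mem_cayleyChart_source {h2 : IsUnit (2 : R)} {u : Rˣ} :
    u ∈ (cayleyChart h2).source ↔ IsUnit (1 + (u : R)) :=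
  ⟨fun hu => hu.2, fun hu => ⟨trivial, hu⟩⟩

lemma cayleyChart_mem_maximalAtlas (h2 : IsUnit (2 : R)) :
    cayleyChart h2 ∈ IsManifold.maximalAtlas 𝓘(𝕜, R) n Rˣ := by
  have h_cayley : ContMDiffOn 𝓘(𝕜, R) 𝓘(𝕜, R) n (cayley : R → R) {a | IsUnit (1 + a)} :=
    contMDiffOn_iff_contDiffOn.2 contDiffOn_cayley
  apply OpenPartialHomeomorph.mem_maximalAtlas_of_contMDiffOn
  · exact h_cayley.comp Units.contMDiff_val.contMDiffOn fun _ hu => mem_cayleyChart_source.1 hu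
  · exact (contMDiffOn_chart_symm (x := (1 : Rˣ))).comp (h_cayley.mono fun _ ha => ha.1)
      fun _ ha => ha.2

lemma one_mem_cayleyChart_source (h2 : IsUnit (2 : R)) : 1 ∈ (cayleyChart h2).source := by
  simpa [one_add_one_eq_two] using h2

end CayleyChart

section FiniteDimensional

open Manifold Module

variable {R : Type*} [NormedRing R] [NormedAlgebra ℝ R] [FiniteDimensional ℝ R]

lemma exists_continuousLinearEquiv_prod_mem_iff {V : Type*} [NormedAddCommGroup V]
    [NormedSpace ℝ V] [FiniteDimensional ℝ V] (P : Submodule ℝ V) :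
    ∃ (Q : Submodule ℝ V) (L : (EuclideanSpace ℝ (Fin (finrank ℝ P)) × Q) ≃L[ℝ] V),
      ∀ v, v ∈ P ↔ (L.symm v).2 = 0 := by
  obtain ⟨Q, hPQ⟩ := P.exists_isCompl
  let e : EuclideanSpace ℝ (Fin (finrank ℝ P)) ≃L[ℝ] P := .ofFinrankEq (by simp)
  exact ⟨Q, (e.prodCongr (.refl ℝ Q)).trans
    (P.prodEquivOfIsCompl Q hPQ).toContinuousLinearEquiv,
    fun v => (Submodule.prodEquivOfIsCompl_symm_apply_snd_eq_zero _ _ hPQ).symm⟩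

theorem exists_chartedSpace_lieGroup_units_unitaryCentralizer [CompleteSpace R] {n : ℕ∞ω}
    (σ : R →ₐ[ℝ] Rᵐᵒᵖ) (s : Set R) :
    ∃ (d : ℕ) (_ : ChartedSpace (EuclideanSpace ℝ (Fin d)) (unitaryCentralizer σ s).units),
      LieGroup (𝓡 d) n (unitaryCentralizer σ s).units ∧
      IsSmoothEmbedding (𝓡 d) 𝓘(ℝ, R) n
        (Subtype.val : (unitaryCentralizer σ s).units → Rˣ) := by
  have h2 : IsUnit (2 : R) := by
    simpa only [map_ofNat] using (IsUnit.mk0 (2 : ℝ) two_ne_zero).map (algebraMap ℝ R)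
  obtain ⟨Q, L, hL⟩ := exists_continuousLinearEquiv_prod_mem_iff (skewCentralizer σ s)
  have h_slice : IsSliceChart L (cayleyChart h2) ((unitaryCentralizer σ s).units : Set Rˣ) := by
    intro u hu
    rw [cayleyChart_apply, ← hL,
      cayley_mem_skewCentralizer_iff h2 (mem_cayleyChart_source.1 hu)]
    exact mem_units_unitaryCentralizer_iff
  exact ⟨_, exists_chartedSpace_lieGroup_of_isSliceChart h_slice
    (cayleyChart_mem_maximalAtlas h2) (one_mem_cayleyChart_source h2)⟩

theorem theorem2_general [CompleteSpace R] {n : ℕ∞ω} (σ : R →ₐ[ℝ] Rᵐᵒᵖ) (s : Set R) :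
    (∀ a ∈ unitaryCentralizer σ s, ∀ b ∈ unitaryCentralizer σ s, a * b ∈ unitaryCentralizer σ s) ∧
    (∀ a ∈ unitaryCentralizer σ s, IsUnit a ∧ a⁻¹ʳ ∈ unitaryCentralizer σ s) ∧
    IsClosed {u : Rˣ | (u : R) ∈ unitaryCentralizer σ s} ∧
    ∃ H : Subgroup Rˣ,
      (fun u : Rˣ => (u : R)) '' (H : Set Rˣ) = unitaryCentralizer σ s ∧
      ∃ (d : ℕ) (_ : ChartedSpace (EuclideanSpace ℝ (Fin d)) H),
        LieGroup (𝓡 d) n H ∧ IsSmoothEmbedding (𝓡 d) 𝓘(ℝ, R) n (Subtype.val : H → Rˣ) := by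
  have : IsArtinianRing R := .of_finite ℝ R
  have h_closed : IsClosed (unitaryCentralizer σ s : Set R) :=
    isClosed_unitaryCentralizer σ.toLinearMap.continuous_of_finiteDimensional
  exact ⟨fun a ha b hb => mul_mem ha hb,
    fun a ha => ⟨isUnit_of_mem_unitaryCentralizer ha, ringInverse_mem_unitaryCentralizer ha⟩,
    h_closed.preimage Units.continuous_val, (unitaryCentralizer σ s).units,
    image_val_units_unitaryCentralizer,
    exists_chartedSpace_lieGroup_units_unitaryCentralizer σ s⟩

end FiniteDimensional

section Block

open Matrix

variable (n K : Type*) [Fintype n] [DecidableEq n] [CommRing K]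

/-- The anti-automorphism of the `2 × 2` block matrices that transposes a matrix and exchanges the
two diagonal blocks. -/
def blockTranspose : Matrix (n ⊕ n) (n ⊕ n) K →ₐ[K] (Matrix (n ⊕ n) (n ⊕ n) K)ᵐᵒᵖ :=
  (transposeAlgEquiv (n ⊕ n) K K).toAlgHom.comp (reindexAlgEquiv K K (.sumComm n n)).toAlgHom

variable {n K}

lemma unop_blockTranspose_fromBlocks (A B C D : Matrix n n K) :
    unop (blockTranspose n K (fromBlocks A B C D)) = fromBlocks Dᵀ Bᵀ Cᵀ Aᵀ := by
  ext (i | i) (j | j) <;> rfl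

lemma fromBlocks_mem_centralizer_iff {A B C D : Matrix n n K} :
    fromBlocks A B C D ∈ ({fromBlocks 0 0 1 0} : Set (Matrix (n ⊕ n) (n ⊕ n) K)).centralizer ↔
      B = 0 ∧ A = D := by
  simp only [Set.mem_centralizer_iff, Set.mem_singleton_iff, forall_eq, fromBlocks_multiply,
    fromBlocks_inj, zero_mul, mul_zero, one_mul, mul_one, zero_add, add_zero]
  tauto

lemma fromBlocks_mem_unitaryCentralizer_iff {A B C D : Matrix n n K} :
    fromBlocks A B C D ∈ unitaryCentralizer (blockTranspose n K) {fromBlocks 0 0 1 0} ↔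
      B = 0 ∧ A = D ∧ Aᵀ * A = 1 ∧ Cᵀ * A + Aᵀ * C = 0 := by
  rw [mem_unitaryCentralizer_iff, fromBlocks_mem_centralizer_iff, and_assoc]
  refine and_congr_right fun hB => and_congr_right fun hD => ?_
  subst hB hD
  simp [unop_blockTranspose_fromBlocks, fromBlocks_multiply, ← fromBlocks_one, fromBlocks_inj,
    and_comm]

lemma transpose_mul_add_transpose_mul_eq_zero_iff {R C : Matrix n n K} (hR : Rᵀ * R = 1) :
    Cᵀ * R + Rᵀ * C = 0 ↔ ∃ S, Sᵀ = -S ∧ C = S * R := by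
  constructor
  · intro hC
    have hR' : R * Rᵀ = 1 := mul_eq_one_comm.1 hR
    refine ⟨C * Rᵀ, ?_, by rw [mul_assoc, hR, mul_one]⟩
    rw [eq_neg_iff_add_eq_zero, transpose_mul, transpose_transpose]
    calc R * Cᵀ + C * Rᵀ = R * Cᵀ * (R * Rᵀ) + R * Rᵀ * C * Rᵀ := by
          rw [hR', mul_one, one_mul]
      _ = R * (Cᵀ * R + Rᵀ * C) * Rᵀ := by noncomm_ring
      _ = 0 := by rw [hC, mul_zero, zero_mul]
  · rintro ⟨S, hS, rfl⟩
    rw [transpose_mul, hS]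
    noncomm_ring

theorem mem_unitaryCentralizer_blockTranspose_iff {M : Matrix (n ⊕ n) (n ⊕ n) K} :
    M ∈ unitaryCentralizer (blockTranspose n K) {fromBlocks 0 0 1 0} ↔
      ∃ R ∈ orthogonalGroup n K, ∃ S : Matrix n n K, Sᵀ = -S ∧ M = fromBlocks R 0 (S * R) R := by
  constructor
  · intro hM
    rw [← fromBlocks_toBlocks M, fromBlocks_mem_unitaryCentralizer_iff] at hM
    obtain ⟨hB, hD, hR, hC⟩ := hM
    obtain ⟨S, hS, hC⟩ := (transpose_mul_add_transpose_mul_eq_zero_iff hR).1 hC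
    refine ⟨M.toBlocks₁₁, (mem_orthogonalGroup_iff' _ _).2 hR, S, hS, ?_⟩
    nth_rw 1 [← fromBlocks_toBlocks M, hB, hC, ← hD]
  · rintro ⟨R, hR, S, hS, rfl⟩
    replace hR : Rᵀ * R = 1 := (mem_orthogonalGroup_iff' _ _).1 hR
    exact fromBlocks_mem_unitaryCentralizer_iff.2
      ⟨rfl, rfl, hR, (transpose_mul_add_transpose_mul_eq_zero_iff hR).2 ⟨S, hS, rfl⟩⟩

end Block

section InducedAdjoint

open Matrix

lemma transpose_eq_neg_iff_exists_hat {S : Matrix (Fin 3) (Fin 3) ℝ} :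
    Sᵀ = -S ↔ ∃ t, S = hat t := by
  constructor
  · intro hS
    have h_skew : ∀ i j, S j i = -S i j := fun i j => congrFun₂ hS i j
    have h_diag : ∀ i, S i i = 0 := fun i => self_eq_neg.1 (h_skew i i)
    refine ⟨![S 2 1, S 0 2, S 1 0], ?_⟩
    ext i j
    fin_cases i <;> fin_cases j <;> simp [hat, h_diag, ← h_skew]
  · rintro ⟨t, rfl⟩
    ext i j
    fin_cases i <;> fin_cases j <;> simp [hat]

lemma inducedAdjointSet_eq_unitaryCentralizer :
    inducedAdjointSet = unitaryCentralizer (blockTranspose (Fin 3) ℝ) {fromBlocks 0 0 1 0} := by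
  ext M
  simp only [SetLike.mem_coe, mem_unitaryCentralizer_blockTranspose_iff,
    transpose_eq_neg_iff_exists_hat]
  constructor
  · rintro ⟨R, hR, t, rfl⟩
    exact ⟨R, hR, hat t, ⟨t, rfl⟩, rfl⟩
  · rintro ⟨R, hR, _, ⟨t, rfl⟩, rfl⟩
    exact ⟨R, hR, t, rfl⟩

end InducedAdjoint

theorem theorem2 :
    (∀ A ∈ inducedAdjointSet, ∀ B ∈ inducedAdjointSet, A * B ∈ inducedAdjointSet) ∧
    (∀ A ∈ inducedAdjointSet, IsUnit A ∧ A⁻¹ ∈ inducedAdjointSet) ∧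
    IsClosed {g : GL6 | (g : Mat6) ∈ inducedAdjointSet} ∧
    ∃ H : Subgroup GL6,
      (fun g : GL6 => (g : Mat6)) '' (H : Set GL6) = inducedAdjointSet ∧
      IsEmbeddedLieSubgroup H := by
  simp only [inducedAdjointSet_eq_unitaryCentralizer, Matrix.nonsing_inv_eq_ringInverse]
  exact theorem2_general (R := Mat6) _ _
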